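/- All graphs are finite. A perfect matching of a graph $G$ is a set of edges such that every vertex of $G$ is incident with exactly one of them. An edge of $G$ is called lonely if it belongs to exactly one perfect matching of $G$, and $G$ is matching double covered if every edge of $G$ belongs to at least two distinct perfect matchings. Let $\mathcal{U}$ be the class of all $3$-connected cubic graphs that are not matching double covered, and let $\mathcal{U}_n$ be the class of all graphs in $\mathcal{U}$ with exactly $n$ lonely edges. Theorem. For every integer $k\ge 2$ there is a graph in $\mathcal{U}_2$ with exactly $k$ triangles, and there is a graph in $\mathcal{U}_1$ with exactly $k$ triangles. -/

import Mathlib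

namespace LonelyEdges

/-- `G` is `k`-connected: it has more than `k` vertices, and deleting fewer than `k` vertices
always leaves a connected graph. -/
def IsVertexConnected {V : Type*} [Fintype V] (G : SimpleGraph V) (k : ℕ) : Prop :=
  k < Fintype.card V ∧
    ∀ S : Finset V, S.card < k → (G.induce {v : V | v ∉ S}).Connected

/-- Every edge of `G` belongs to at least two distinct perfect matchings. -/
def IsMatchingDoubleCovered {V : Type*} (G : SimpleGraph V) : Prop :=
  ∀ e ∈ G.edgeSet, ∃ M₁ M₂ : G.Subgraph, M₁ ≠ M₂ ∧
    M₁.IsPerfectMatching ∧ M₂.IsPerfectMatching ∧ e ∈ M₁.edgeSet ∧ e ∈ M₂.edgeSet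

/-- The lonely edges of `G`: the edges that belong to exactly one perfect matching. -/
def lonelyEdges {V : Type*} (G : SimpleGraph V) : Set (Sym2 V) :=
  {e | e ∈ G.edgeSet ∧ ∃! M : G.Subgraph, M.IsPerfectMatching ∧ e ∈ M.edgeSet}

/-- The class `𝒰` of `3`-connected cubic graphs that are not matching double covered.
(A `3`-connected cubic graph has no parallel edges, so simple graphs suffice.) -/
structure InU {V : Type*} [Fintype V] (G : SimpleGraph V) [DecidableRel G.Adj] : Prop where
  cubic : G.IsRegularOfDegree 3
  threeConnected : IsVertexConnected G 3
  notDoubleCovered : ¬ IsMatchingDoubleCovered G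

/-- The class `𝒰_n` of the graphs in `𝒰` with exactly `n` lonely edges. -/
def InUWith {V : Type*} [Fintype V] (G : SimpleGraph V) [DecidableRel G.Adj] (n : ℕ) : Prop :=
  InU G ∧ (lonelyEdges G).ncard = n

end LonelyEdges

/-!
Truncating a vertex `v` replaces it by a triangle. A perfect matching of the truncation uses either
one of the three spokes at `v`, in which case it comes from a perfect matching of the original
graph, or all three of them, in which case it comes from a *tripod* at `v`. Hence an edge away from
`v` that lies in no tripod keeps its number of perfect matchings, and no other edge of the
truncation lies in fewer perfect matchings than the edge of the original graph it comes from.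

Let `v r` be a lonely edge at a vertex `v` with neighbours `p`, `q`, `r`. We truncate `v`, and then
the corner of the new triangle that leads to `r`. After the first truncation the tripods at `v`
provide a second perfect matching through the edge that leads to `r`, and the edge of the triangle
opposite to that corner is lonely instead. The second truncation destroys the first triangle, so
that `v` again has a lonely edge and lies in no triangle. Altogether one triangle is added, while
`3`-connectedness is preserved. The tripods that occur in the next step come from perfect matchings
through `v r` and `v p`, so a second lonely edge survives if its perfect matching contains `v q`.
It remains to find, with one and with two lonely edges, a graph with two triangles to start from.
-/

namespace LonelyEdges

section Matings

variable {V : Type*} {G : SimpleGraph V}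

/-- A perfect matching of `G - S`, encoded as the involution that exchanges matched vertices and
fixes the vertices of `S`. -/
structure IsMating (G : SimpleGraph V) (S : Set V) (f : V → V) : Prop where
  involutive : Function.Involutive f
  fixed : ∀ v ∈ S, f v = v
  adj : ∀ v ∉ S, G.Adj v (f v)

/-- The perfect matchings of `G - S` that contain the edge `e`, as involutions. -/
def matingsThrough (G : SimpleGraph V) (S : Set V) (e : Sym2 V) : Set (V → V) :=
  {f | IsMating G S f ∧ ∃ a ∉ S, s(a, f a) = e}

lemma IsMating.adj_apply {f : V → V} (hf : IsMating G ∅ f) (v : V) : G.Adj v (f v) :=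
  hf.adj v (Set.notMem_empty v)

lemma isMating_empty_iff {f : V → V} :
    IsMating G ∅ f ↔ Function.Involutive f ∧ ∀ v, G.Adj v (f v) :=
  ⟨fun hf => ⟨hf.involutive, hf.adj_apply⟩, fun hf => ⟨hf.1, by simp, fun v _ => hf.2 v⟩⟩

lemma IsMating.apply_notMem {S : Set V} {f : V → V} (hf : IsMating G S f) {a : V} (ha : a ∉ S) :
    f a ∉ S := fun hS =>
  (hf.adj a ha).ne ((hf.involutive a).symm.trans (hf.fixed _ hS))

lemma mem_matingsThrough_mk {S : Set V} {f : V → V} {a b : V} :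
    f ∈ matingsThrough G S s(a, b) ↔ IsMating G S f ∧ a ∉ S ∧ f a = b := by
  refine and_congr_right fun hf => ⟨?_, fun ⟨ha, hab⟩ => ⟨a, ha, by rw [hab]⟩⟩
  rintro ⟨c, hc, he⟩
  obtain ⟨rfl, h⟩ | ⟨rfl, rfl⟩ := Sym2.eq_iff.1 he
  · exact ⟨hc, h⟩
  · exact ⟨hf.apply_notMem hc, hf.involutive c⟩

/-- The perfect matching of `G`, as a subgraph, encoded by an involution. -/
def IsMating.toSubgraph {f : V → V} (hf : IsMating G ∅ f) : G.Subgraph where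
  verts := Set.univ
  Adj v w := f v = w
  adj_sub := by rintro v _ rfl; exact hf.adj_apply v
  edge_vert _ := Set.mem_univ _
  symm := ⟨by rintro v _ rfl; exact hf.involutive v⟩

lemma IsMating.isPerfectMatching_toSubgraph {f : V → V} (hf : IsMating G ∅ f) :
    hf.toSubgraph.IsPerfectMatching :=
  ⟨fun v _ => ⟨f v, rfl, fun _ hw => Eq.symm hw⟩, fun v => Set.mem_univ v⟩

lemma exists_toSubgraph_eq {M : G.Subgraph} (hM : M.IsPerfectMatching) :
    ∃ (f : V → V) (hf : IsMating G ∅ f), hf.toSubgraph = M := by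
  choose f hadj huniq using fun v => hM.1 (hM.2 v)
  have hf : IsMating G ∅ f := isMating_empty_iff.2
    ⟨fun v => (huniq _ _ (hadj v).symm).symm, fun v => M.adj_sub (hadj v)⟩
  refine ⟨f, hf, SimpleGraph.Subgraph.ext (Set.eq_univ_of_forall hM.2).symm ?_⟩
  ext v w
  exact ⟨fun h : f v = w => h ▸ hadj v, fun h => (huniq v w h).symm⟩

lemma IsMating.toSubgraph_injective {f g : V → V} (hf : IsMating G ∅ f) (hg : IsMating G ∅ g)
    (h : hf.toSubgraph = hg.toSubgraph) : f = g := by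
  funext v
  have hadj : hf.toSubgraph.Adj v (f v) := rfl
  rw [h] at hadj
  exact Eq.symm hadj

lemma IsMating.mem_edgeSet_toSubgraph_iff {f : V → V} (hf : IsMating G ∅ f) {e : Sym2 V} :
    e ∈ hf.toSubgraph.edgeSet ↔ f ∈ matingsThrough G ∅ e := by
  induction e with | _ a b
  exact ⟨fun h => mem_matingsThrough_mk.2 ⟨hf, Set.notMem_empty a, h⟩,
    fun h => (mem_matingsThrough_mk.1 h).2.2⟩

lemma mem_edgeSet_of_mem_matingsThrough {S : Set V} {f : V → V} {e : Sym2 V}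
    (hf : f ∈ matingsThrough G S e) : e ∈ G.edgeSet := by
  obtain ⟨hf, a, ha, rfl⟩ := hf
  exact hf.adj a ha

lemma mem_lonelyEdges_iff {e : Sym2 V} : e ∈ lonelyEdges G ↔ ∃ f, matingsThrough G ∅ e = {f} := by
  simp only [Set.eq_singleton_iff_unique_mem]
  constructor
  · rintro ⟨-, M, ⟨hM, he⟩, huniq⟩
    obtain ⟨f, hf, rfl⟩ := exists_toSubgraph_eq hM
    refine ⟨f, hf.mem_edgeSet_toSubgraph_iff.1 he, fun g hg => ?_⟩
    exact hg.1.toSubgraph_injective hf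
      (huniq _ ⟨hg.1.isPerfectMatching_toSubgraph, hg.1.mem_edgeSet_toSubgraph_iff.2 hg⟩)
  · rintro ⟨f, hf, huniq⟩
    refine ⟨mem_edgeSet_of_mem_matingsThrough hf, hf.1.toSubgraph,
      ⟨hf.1.isPerfectMatching_toSubgraph, hf.1.mem_edgeSet_toSubgraph_iff.2 hf⟩, ?_⟩
    rintro M ⟨hM, he⟩
    obtain ⟨g, hg, rfl⟩ := exists_toSubgraph_eq hM
    obtain rfl := huniq g (hg.mem_edgeSet_toSubgraph_iff.1 he)
    rfl

lemma not_isMatchingDoubleCovered_of_mem_lonelyEdges {e : Sym2 V} (he : e ∈ lonelyEdges G) :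
    ¬ IsMatchingDoubleCovered G := by
  intro hG
  obtain ⟨M₁, M₂, hne, h₁, h₂, he₁, he₂⟩ := hG e he.1
  exact hne (he.2.unique ⟨h₁, he₁⟩ ⟨h₂, he₂⟩)

end Matings

section SwapEdge

variable {V : Type*} [DecidableEq V] {G : SimpleGraph V} {S : Set V} {f : V → V} {x y : V}

lemma IsMating.removeEdge (hf : IsMating G S f) (hxy : f x = y) :
    IsMating G (insert x (insert y S)) (Equiv.swap x y ∘ f) := by
  have hinv : ∀ a, f (f a) = a := hf.involutive
  have hy : f y = x := hxy ▸ hinv x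
  refine ⟨fun a => ?_, fun a ha => ?_, fun a ha => ?_⟩
  · grind
  · have := hf.fixed a
    grind
  · have := hf.adj a
    grind

lemma IsMating.insertEdge (hf : IsMating G (insert x (insert y S)) f) (hx : x ∉ S) (hy : y ∉ S)
    (hxy : G.Adj x y) : IsMating G S (Equiv.swap x y ∘ f) := by
  have hinv : ∀ a, f (f a) = a := hf.involutive
  have hfx : f x = x := hf.fixed x (by simp)
  have hfy : f y = y := hf.fixed y (by simp)
  refine ⟨fun a => ?_, fun a ha => ?_, fun a ha => ?_⟩
  · grind
  · have := hf.fixed a (by simp [ha])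
    grind
  · have := hf.adj a
    have := hxy.symm
    grind

end SwapEdge

section Truncation

variable {V : Type*} {G : SimpleGraph V} {v p q r : V}

/-- The vertices adjacent to `v` are exactly the three distinct vertices `p`, `q`, `r`. -/
structure HasNeighbors (G : SimpleGraph V) (v p q r : V) : Prop where
  adj_iff : ∀ w, G.Adj v w ↔ w = p ∨ w = q ∨ w = r
  ne₁₂ : p ≠ q
  ne₁₃ : p ≠ r
  ne₂₃ : q ≠ r

/-- Truncation of `G` at the vertex `v`: the vertex is replaced by a triangle `inl v`, `inr 0`,
`inr 1`, of which `inr 0` and `inr 1` take over the edges from `v` to `q` and `r`. -/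
def truncate (G : SimpleGraph V) (v q r : V) : SimpleGraph (V ⊕ Fin 2) :=
  (G.deleteEdges {s(v, q), s(v, r)}).map Function.Embedding.inl ⊔
    SimpleGraph.fromEdgeSet {s(.inl v, .inr 0), s(.inl v, .inr 1), s(.inr 0, .inr 1),
      s(.inl q, .inr 0), s(.inl r, .inr 1)}

@[simp]
lemma truncate_adj_inl_inl {a b : V} :
    (truncate G v q r).Adj (.inl a) (.inl b) ↔
      G.Adj a b ∧ s(a, b) ≠ s(v, q) ∧ s(a, b) ≠ s(v, r) := by
  simp [truncate, SimpleGraph.map_adj]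

@[simp]
lemma truncate_adj_inl_inr {a : V} {i : Fin 2} :
    (truncate G v q r).Adj (.inl a) (.inr i) ↔ a = v ∨ a = ![q, r] i := by
  fin_cases i <;> simp [truncate, SimpleGraph.map_adj]

@[simp]
lemma truncate_adj_inr_inl {a : V} {i : Fin 2} :
    (truncate G v q r).Adj (.inr i) (.inl a) ↔ a = v ∨ a = ![q, r] i := by
  rw [SimpleGraph.adj_comm, truncate_adj_inl_inr]

@[simp]
lemma truncate_adj_inr_inr {i j : Fin 2} : (truncate G v q r).Adj (.inr i) (.inr j) ↔ i ≠ j := by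
  fin_cases i <;> fin_cases j <;> simp [truncate, SimpleGraph.map_adj]

/-- The closed neighbourhood of `v`: the vertices covered by the three edges at `v`. -/
def closedNeighborSet (G : SimpleGraph V) (v : V) : Set V := insert v (G.neighborSet v)

lemma HasNeighbors.closedNeighborSet_eq (h : HasNeighbors G v p q r) :
    closedNeighborSet G v = {v, p, q, r} := by
  ext w
  simp [closedNeighborSet, h.adj_iff]

lemma HasNeighbors.swap_right (h : HasNeighbors G v p q r) : HasNeighbors G v p r q :=
  ⟨fun w => (h.adj_iff w).trans (or_congr_right or_comm), h.ne₁₃, h.ne₁₂, h.ne₂₃.symm⟩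

lemma HasNeighbors.ne_left (h : HasNeighbors G v p q r) : v ≠ p ∧ v ≠ q ∧ v ≠ r :=
  ⟨((h.adj_iff p).2 (by simp)).ne, ((h.adj_iff q).2 (by simp)).ne, ((h.adj_iff r).2 (by simp)).ne⟩

lemma HasNeighbors.truncate_inl (h : HasNeighbors G v p q r) :
    HasNeighbors (truncate G v q r) (.inl v) (.inl p) (.inr 0) (.inr 1) := by
  refine ⟨?_, by simp, by simp, by simp⟩
  have := h.ne_left
  have := h.ne₁₂
  have := h.ne₁₃
  rintro (a | i)
  · grind [truncate_adj_inl_inl, h.adj_iff]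
  · fin_cases i <;> simp

lemma HasNeighbors.truncate_inr_zero (h : HasNeighbors G v p q r) :
    HasNeighbors (truncate G v q r) (.inr 0) (.inl q) (.inl v) (.inr 1) := by
  refine ⟨?_, by simp [h.ne_left.2.1.symm], by simp, by simp⟩
  rintro (a | i)
  · simp [or_comm]
  · fin_cases i <;> simp

lemma HasNeighbors.truncate_inr_one (h : HasNeighbors G v p q r) :
    HasNeighbors (truncate G v q r) (.inr 1) (.inl r) (.inl v) (.inr 0) := by
  refine ⟨?_, by simp [h.ne_left.2.2.symm], by simp, by simp⟩
  rintro (a | i)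
  · simp [or_comm]
  · fin_cases i <;> simp

open Classical in
/-- The triangle vertex of the truncation at `v` that is joined to the neighbour `w` of `v`. -/
noncomputable def corner (v q r w : V) : V ⊕ Fin 2 :=
  if w = q then .inr 0 else if w = r then .inr 1 else .inl v

open Classical in
lemma HasNeighbors.truncate_of_ne (h : HasNeighbors G v p q r) {w a b c : V} (hw : w ≠ v)
    (hwn : HasNeighbors G w a b c) :
    HasNeighbors (truncate G v q r) (.inl w) (if a = v then corner v q r w else .inl a)
      (if b = v then corner v q r w else .inl b) (if c = v then corner v q r w else .inl c) := by
  have hv := h.adj_iff w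
  rw [SimpleGraph.adj_comm, hwn.adj_iff] at hv
  obtain ⟨-, _, _⟩ := h.ne_left
  have h₂₃ := h.ne₂₃
  obtain ⟨hadj, hab, hac, hbc⟩ := hwn
  refine ⟨?_, ?_, ?_, ?_⟩
  · rintro (u | i)
    · simp only [truncate_adj_inl_inl, hadj, corner, ne_eq, Sym2.eq_iff]
      grind
    · rw [truncate_adj_inl_inr]
      fin_cases i <;> grind [corner, Matrix.cons_val_zero, Matrix.cons_val_one]
  all_goals grind [corner]

/-- The step of the construction: `G` is truncated at `v`, and the result is truncated at the corner
that leads to `r`, which destroys the first triangle. -/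
abbrev truncateTwice (G : SimpleGraph V) (v q r : V) : SimpleGraph ((V ⊕ Fin 2) ⊕ Fin 2) :=
  truncate (truncate G v q r) (.inr 1) (.inl v) (.inr 0)

protected lemma HasNeighbors.truncateTwice (h : HasNeighbors G v p q r) :
    HasNeighbors (truncateTwice G v q r)
      (.inl (.inl v)) (.inl (.inl p)) (.inr 0) (.inl (.inr 0)) := by
  simpa [corner] using (h.truncate_inr_one.truncate_of_ne (by simp) h.truncate_inl).swap_right

lemma HasNeighbors.closedNeighborSet_truncateTwice (h : HasNeighbors G v p q r) :
    closedNeighborSet (truncateTwice G v q r) (.inl (.inl v)) =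
      {.inl (.inl v), .inl (.inl p), .inl (.inr 0), .inr 0} := by
  rw [h.truncateTwice.swap_right.closedNeighborSet_eq]

end Truncation

section Tripods

variable {V : Type*} {G : SimpleGraph V} {v p q r : V}

lemma isMating_truncate_iff {S : Set (V ⊕ Fin 2)} {t : V ⊕ Fin 2 → V ⊕ Fin 2}
    (hv : .inl v ∈ S) (hS : ∀ i, .inr i ∈ S) :
    IsMating (truncate G v q r) S t ↔ ∃ f, IsMating G (.inl ⁻¹' S) f ∧ t = Sum.map f id := by
  have hadj : ∀ a b, a ≠ v → b ≠ v →
      ((truncate G v q r).Adj (.inl a) (.inl b) ↔ G.Adj a b) := by grind [truncate_adj_inl_inl]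
  constructor
  · intro ht
    have hinl : ∀ a, ∃ b, t (.inl a) = .inl b := fun a => by
      rcases h : t (.inl a) with b | i
      · exact ⟨b, rfl⟩
      · have := ht.involutive (.inl a)
        rw [h, ht.fixed _ (hS i)] at this
        exact absurd this (by simp)
    choose f hf using hinl
    refine ⟨f, ⟨fun a => ?_, fun a ha => ?_, fun a ha => ?_⟩, ?_⟩
    · have := ht.involutive (.inl a)
      simpa [hf] using this
    · simpa [hf] using ht.fixed _ ha
    · have hav : a ≠ v := fun h => ha (h ▸ hv)
      have hfa : f a ≠ v := fun h => ht.apply_notMem ha (by rwa [hf, h])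
      exact (hadj a _ hav hfa).1 (hf a ▸ ht.adj _ ha)
    · ext (a | i) : 1
      · exact hf a
      · exact ht.fixed _ (hS i)
  · rintro ⟨f, hf, rfl⟩
    refine ⟨?_, ?_, ?_⟩
    · rintro (a | i)
      · exact congrArg Sum.inl (hf.involutive a)
      · rfl
    · rintro (a | i) h
      · simp [hf.fixed a h]
      · rfl
    · rintro (a | i) h
      · have hav : a ≠ v := fun h' => h (h' ▸ hv)
        have hfa : f a ≠ v := fun h' => hf.apply_notMem h (by simpa [h'] using hv)
        exact (hadj a _ hav hfa).2 (hf.adj a h)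
      · exact absurd (hS i) h

lemma exists_isMating_eq_map_of_truncate (h : HasNeighbors G v p q r)
    {t : V ⊕ Fin 2 → V ⊕ Fin 2}
    (ht : IsMating (truncate G v q r) (closedNeighborSet (truncate G v q r) (.inr 1)) t) :
    ∃ f, IsMating G {v, r} f ∧ t = Sum.map f id := by
  rw [h.truncate_inr_one.closedNeighborSet_eq] at ht
  obtain ⟨f, hf, rfl⟩ := (isMating_truncate_iff (by simp)
    (by simp [Fin.forall_fin_two])).1 ht
  refine ⟨f, ?_, rfl⟩
  convert hf using 1
  ext a
  simp [or_comm]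

lemma isMating_truncateTwice_iff [DecidableEq V] (h : HasNeighbors G v p q r)
    {t : (V ⊕ Fin 2) ⊕ Fin 2 → (V ⊕ Fin 2) ⊕ Fin 2} :
    IsMating (truncateTwice G v q r) (closedNeighborSet (truncateTwice G v q r) (.inl (.inl v))) t ↔
    ∃ f, IsMating G {v, p} f ∧
      t = Equiv.swap (.inl (.inr 1)) (.inr 1) ∘ Sum.map (Sum.map f id) id := by
  rw [h.closedNeighborSet_truncateTwice]
  set S : Set ((V ⊕ Fin 2) ⊕ Fin 2) := {.inl (.inl v), .inl (.inl p), .inl (.inr 0), .inr 0}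
    with hS
  set S' := insert (.inl (.inr 1)) (insert (.inr 1) S) with hS'
  have hpre : ({v, p} : Set V) = .inl ⁻¹' (.inl ⁻¹' S' : Set (V ⊕ Fin 2)) := by
    ext a
    simp [hS', hS]
  have hoff (t) : IsMating (truncateTwice G v q r) S' t ↔
      ∃ f, IsMating G {v, p} f ∧ t = Sum.map (Sum.map f id) id := by
    rw [isMating_truncate_iff (by simp [hS']) (by simp [Fin.forall_fin_two, hS', hS])]
    have hinner (t) : IsMating (truncate G v q r) (.inl ⁻¹' S') t ↔
        ∃ f, IsMating G {v, p} f ∧ t = Sum.map f id := by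
      rw [hpre]
      exact isMating_truncate_iff (by simp [hS', hS]) (by simp [Fin.forall_fin_two, hS', hS])
    simp only [hinner]
    grind
  constructor
  · intro ht
    -- The two remaining vertices of the triangle can only be matched with each other.
    have hu : t (.inl (.inr 1)) = .inr 1 := by
      have hadj := ht.adj (.inr 1) (by simp [hS])
      have hnot := ht.apply_notMem (a := .inr 1) (by simp [hS])
      rw [h.truncate_inr_one.truncate_inr_one.adj_iff] at hadj
      simp only [hS, Set.mem_insert_iff, not_or, Set.mem_singleton_iff] at hnot
      rw [← ht.involutive (.inr 1)]
      grind
    obtain ⟨f, hf, hft⟩ := (hoff _).1 (ht.removeEdge hu)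
    refine ⟨f, hf, ?_⟩
    rw [← hft, ← Function.comp_assoc, ← Equiv.coe_trans]
    simp
  · rintro ⟨f, hf, rfl⟩
    exact ((hoff _).2 ⟨f, hf, rfl⟩).insertEdge (by simp [hS]) (by simp [hS]) (by simp)

end Tripods

section Lifting

variable {V : Type*} {G : SimpleGraph V} {v p q r : V}

open Classical in
/-- The perfect matching of the truncation at `v` that agrees with the perfect matching `f` of `G`
away from the new triangle: the spoke of `f` at `v` is kept, and the other two vertices of the
triangle are matched with each other. -/
noncomputable def liftMating (v q r : V) (f : V → V) : V ⊕ Fin 2 → V ⊕ Fin 2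
  | .inl a =>
    if a = v then if f v = q then .inr 1 else if f v = r then .inr 0 else .inl (f v)
    else if f a = v then corner v q r a else .inl (f a)
  | .inr 0 => if f v = q then .inl q else if f v = r then .inl v else .inr 1
  | .inr 1 => if f v = r then .inl r else if f v = q then .inl v else .inr 0

lemma IsMating.lift (h : HasNeighbors G v p q r) {f : V → V} (hf : IsMating G ∅ f) :
    IsMating (truncate G v q r) ∅ (liftMating v q r f) := by
  rw [isMating_empty_iff] at hf ⊢
  obtain ⟨hinv, hadj⟩ := hf
  have := (h.adj_iff _).1 (hadj v)
  have hne := fun a => (hadj a).ne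
  obtain ⟨_, _, _, _⟩ := h
  have hinv : ∀ a, f (f a) = a := hinv
  refine ⟨?_, ?_⟩
  · rintro (a | i)
    · grind [liftMating, corner]
    · fin_cases i <;> grind [liftMating, corner]
  · rintro (a | i)
    · have := hinv a
      have := hadj a
      grind [liftMating, corner, truncate_adj_inl_inl, truncate_adj_inl_inr, Matrix.cons_val_zero,
        Matrix.cons_val_one]
    · fin_cases i <;>
        grind [liftMating, truncate_adj_inr_inl, truncate_adj_inr_inr, Matrix.cons_val_zero,
          Matrix.cons_val_one]

/-- Contraction of the triangle created by truncation at `v` back to `v`. -/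
def contract (v : V) : V ⊕ Fin 2 → V
  | .inl a => a
  | .inr _ => v

open Classical in
/-- The perfect matching of `G` obtained by contracting the new triangle. The partner of `v` is read
off from `g (inl v)`, which is correct only if `g` uses just one of the three spokes. -/
noncomputable def lowerMating (v p q r : V) (g : V ⊕ Fin 2 → V ⊕ Fin 2) (a : V) : V :=
  if a = v then if g (.inl v) = .inr 1 then q else if g (.inl v) = .inr 0 then r else p
  else contract v (g (.inl a))

lemma IsMating.apply_inl_of_truncate {g : V ⊕ Fin 2 → V ⊕ Fin 2}
    (hg : IsMating (truncate G v q r) ∅ g) {a : V} (ha : a ≠ v) :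
    (∃ b, g (.inl a) = .inl b ∧ G.Adj a b) ∨ (a = q ∧ g (.inl a) = .inr 0) ∨
      (a = r ∧ g (.inl a) = .inr 1) := by
  have hadj := hg.adj_apply (.inl a)
  generalize g (.inl a) = y at hadj ⊢
  rcases y with b | i
  · exact .inl ⟨b, rfl, (truncate_adj_inl_inl.1 hadj).1⟩
  · rw [truncate_adj_inl_inr, or_iff_right ha] at hadj
    fin_cases i
    · exact .inr (.inl ⟨hadj, rfl⟩)
    · exact .inr (.inr ⟨hadj, rfl⟩)

lemma IsMating.liftMating_lowerMating (h : HasNeighbors G v p q r) {g : V ⊕ Fin 2 → V ⊕ Fin 2}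
    (hg : IsMating (truncate G v q r) ∅ g) (hspoke : g (.inr 0) ≠ .inl q ∨ g (.inr 1) ≠ .inl r) :
    liftMating v q r (lowerMating v p q r g) = g := by
  have hgv := (h.truncate_inl.adj_iff _).1 (hg.adj_apply _)
  have hg0 := (h.truncate_inr_zero.adj_iff _).1 (hg.adj_apply _)
  have hg1 := (h.truncate_inr_one.adj_iff _).1 (hg.adj_apply _)
  have hinv : ∀ x, g (g x) = x := hg.involutive
  obtain ⟨hp, hq, hr⟩ := h.ne_left
  obtain ⟨-, hpq, hpr, hqr⟩ := h
  ext (a | i) : 1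
  · rcases eq_or_ne a v with rfl | ha
    · grind [liftMating, lowerMating]
    · obtain ⟨b, hb, -⟩ | ⟨rfl, hb⟩ | ⟨rfl, hb⟩ := hg.apply_inl_of_truncate ha <;>
        grind [liftMating, lowerMating, corner, contract]
  · fin_cases i <;> grind [liftMating, lowerMating]

lemma IsMating.lower (h : HasNeighbors G v p q r) {g : V ⊕ Fin 2 → V ⊕ Fin 2}
    (hg : IsMating (truncate G v q r) ∅ g) (hspoke : g (.inr 0) ≠ .inl q ∨ g (.inr 1) ≠ .inl r) :
    IsMating G ∅ (lowerMating v p q r g) := by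
  have hgv := (h.truncate_inl.adj_iff _).1 (hg.adj_apply _)
  have hg0 := (h.truncate_inr_zero.adj_iff _).1 (hg.adj_apply _)
  have hg1 := (h.truncate_inr_one.adj_iff _).1 (hg.adj_apply _)
  have hinv : ∀ x, g (g x) = x := hg.involutive
  obtain ⟨hp, hq, hr⟩ := h.ne_left
  obtain ⟨hN, hpq, hpr, hqr⟩ := h
  rw [isMating_empty_iff]
  refine ⟨fun a => ?_, fun a => ?_⟩
  all_goals
    rcases eq_or_ne a v with rfl | ha
    · grind [lowerMating, contract]
    · obtain ⟨b, hb, hab⟩ | ⟨rfl, hb⟩ | ⟨rfl, hb⟩ := hg.apply_inl_of_truncate ha <;>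
        grind [lowerMating, contract, SimpleGraph.adj_comm]

lemma IsMating.lowerMating_liftMating (h : HasNeighbors G v p q r) {f : V → V}
    (hf : IsMating G ∅ f) : lowerMating v p q r (liftMating v q r f) = f := by
  have hfv := (h.adj_iff _).1 (hf.adj_apply _)
  have hinv : ∀ x, f (f x) = x := hf.involutive
  obtain ⟨hp, hq, hr⟩ := h.ne_left
  obtain ⟨-, hpq, hpr, hqr⟩ := h
  ext a
  rcases eq_or_ne a v with rfl | ha <;> grind [lowerMating, liftMating, corner, contract]

end Lifting

section Lonely

variable {V : Type*} {G : SimpleGraph V} {v p q r : V} {e : Sym2 V}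

lemma isMating_truncate_iff_exists_tripod [DecidableEq V] (h : HasNeighbors G v p q r)
    {g : V ⊕ Fin 2 → V ⊕ Fin 2} :
    IsMating (truncate G v q r) ∅ g ∧ g (.inr 0) = .inl q ∧ g (.inr 1) = .inl r ↔
      ∃ t, IsMating G (closedNeighborSet G v) t ∧ g = Equiv.swap (.inl v) (.inl p) ∘
        Equiv.swap (.inr 0) (.inl q) ∘ Equiv.swap (.inr 1) (.inl r) ∘ Sum.map t id := by
  obtain ⟨_, hq, hr⟩ := h.ne_left
  have h₁₂ := h.ne₁₂
  have h₁₃ := h.ne₁₃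
  have h₂₃ := h.ne₂₃
  set S : Set (V ⊕ Fin 2) := insert (.inr 1) (insert (.inl r) (insert (.inr 0)
      (insert (.inl q) (insert (.inl v) (insert (.inl p) ∅))))) with hS
  have hpre : closedNeighborSet G v = .inl ⁻¹' S := by
    ext a
    simp only [h.closedNeighborSet_eq, hS, Set.mem_preimage, Set.mem_insert_iff,
      Set.mem_singleton_iff, Set.mem_empty_iff_false, Sum.inl.injEq, reduceCtorEq]
    grind
  have hoff (g) : IsMating (truncate G v q r) S g ↔
      ∃ t, IsMating G (closedNeighborSet G v) t ∧ g = Sum.map t id := by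
    rw [hpre]
    exact isMating_truncate_iff (by simp [hS]) (by simp [Fin.forall_fin_two, hS])
  constructor
  · rintro ⟨hg, hq₀, hr₁⟩
    have hv : g (.inl v) = .inl p := by
      have hadj := (h.truncate_inl.adj_iff _).1 (hg.adj_apply _)
      have := hg.involutive (.inl v)
      grind
    obtain ⟨t, ht, hgt⟩ := (hoff _).1 (((hg.removeEdge hv).removeEdge (x := .inr 0) (y := .inl q)
      (by grind)).removeEdge (x := .inr 1) (y := .inl r)
      (by grind))
    refine ⟨t, ht, ?_⟩
    rw [← hgt]
    ext x : 1
    simp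
  · rintro ⟨t, ht, rfl⟩
    have := ht.fixed
    have hg := ((((hoff _).2 ⟨t, ht, rfl⟩).insertEdge (by simp [*, Ne.symm])
      (by simp [*, Ne.symm]) (by simp)).insertEdge
      (by simp [*, Ne.symm]) (by simp [*, Ne.symm]) (by simp)).insertEdge
      (by simp) (by simp) (by simp [h.truncate_inl.adj_iff])
    refine ⟨hg, ?_, ?_⟩ <;>
      grind [h.closedNeighborSet_eq]

lemma liftMating_inl {f : V → V} {a : V} (ha : a ≠ v) (hfa : f a ≠ v) :
    liftMating v q r f (.inl a) = .inl (f a) := by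
  simp [liftMating, ha, hfa]

lemma exists_mem_matingsThrough_apply_eq {x y : V} {t : V → V} (hxy : G.Adj x y)
    (ht : t ∈ matingsThrough G {x, y} e) : ∃ f ∈ matingsThrough G ∅ e, f x = y := by
  classical
  obtain ⟨ht, a, ha, rfl⟩ := ht
  have hta := ht.apply_notMem ha
  have hx : t x = x := ht.fixed x (by simp)
  rw [← insert_empty_eq y] at ht
  simp only [Set.mem_insert_iff, Set.mem_singleton_iff, not_or] at hta
  exact ⟨_, mem_matingsThrough_mk.2 ⟨ht.insertEdge (by simp) (by simp) hxy, by simp,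
    Equiv.swap_apply_of_ne_of_ne hta.1 hta.2⟩, by simp [hx]⟩

lemma matingsThrough_truncate (h : HasNeighbors G v p q r) (hv : v ∉ e)
    (he : matingsThrough G (closedNeighborSet G v) e = ∅) :
    matingsThrough (truncate G v q r) ∅ (e.map .inl) =
      liftMating v q r '' matingsThrough G ∅ e := by
  classical
  induction e with | _ a b
  simp only [Sym2.mem_iff, not_or] at hv
  ext g
  rw [Sym2.map_mk, mem_matingsThrough_mk, Set.mem_image]
  constructor
  · rintro ⟨hg, -, hab⟩
    have hspoke : g (.inr 0) ≠ .inl q ∨ g (.inr 1) ≠ .inl r := by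
      by_contra! hspokes
      obtain ⟨t, ht, rfl⟩ := (isMating_truncate_iff_exists_tripod h).1 ⟨hg, hspokes⟩
      have hfix := ht.fixed a
      have hout := ht.apply_notMem (a := a)
      have := h.ne_left
      simp only [Function.comp_apply, Sum.map_inl] at hab
      refine he.subset (mem_matingsThrough_mk.2 ⟨ht, ?_⟩)
      simp only [h.closedNeighborSet_eq, Set.mem_insert_iff, Set.mem_singleton_iff] at hfix hout ⊢
      clear hspokes hg he
      grind
    refine ⟨lowerMating v p q r g, mem_matingsThrough_mk.2 ⟨hg.lower h hspoke, by simp, ?_⟩,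
      hg.liftMating_lowerMating h hspoke⟩
    simp [lowerMating, Ne.symm hv.1, hab, contract]
  · rintro ⟨f, hf, rfl⟩
    obtain ⟨hmating, -, rfl⟩ := mem_matingsThrough_mk.1 hf
    exact ⟨hmating.lift h, by simp, liftMating_inl (Ne.symm hv.1) (Ne.symm hv.2)⟩

lemma matingsThrough_truncate_inl_inr_zero (h : HasNeighbors G v p q r) :
    matingsThrough (truncate G v q r) ∅ s(.inl v, .inr 0) =
      liftMating v q r '' matingsThrough G ∅ s(v, r) := by
  ext g
  rw [mem_matingsThrough_mk, Set.mem_image]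
  constructor
  · rintro ⟨hg, -, hg0⟩
    have hspoke : g (.inr 0) ≠ .inl q ∨ g (.inr 1) ≠ .inl r := by
      rw [← hg0, hg.involutive]
      exact .inl fun h' => h.ne_left.2.1 (Sum.inl_injective h')
    refine ⟨lowerMating v p q r g, mem_matingsThrough_mk.2 ⟨hg.lower h hspoke, by simp, ?_⟩,
      hg.liftMating_lowerMating h hspoke⟩
    simp [lowerMating, hg0]
  · rintro ⟨f, hf, rfl⟩
    obtain ⟨hf, -, hr⟩ := mem_matingsThrough_mk.1 hf
    exact ⟨hf.lift h, by simp, by simp [liftMating, hr, h.ne₂₃.symm]⟩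

/-- Every edge of `G` outside `E` lies in at least two perfect matchings. -/
def IsDoubleCoveredOff (G : SimpleGraph V) (E : Set (Sym2 V)) : Prop :=
  ∀ e ∈ G.edgeSet, e ∉ E → (matingsThrough G ∅ e).Nontrivial

lemma HasNeighbors.mem_edgeSet_truncate (h : HasNeighbors G v p q r) {e' : Sym2 (V ⊕ Fin 2)}
    (he' : e' ∈ (truncate G v q r).edgeSet) :
    (∃ e ∈ G.edgeSet, v ∉ e ∧ e' = e.map .inl) ∨ e' = s(.inl v, .inl p) ∨
      e' = s(.inl v, .inr 0) ∨ e' = s(.inl v, .inr 1) ∨ e' = s(.inr 0, .inr 1) ∨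
      e' = s(.inr 0, .inl q) ∨ e' = s(.inr 1, .inl r) := by
  have hcorner {x y : V ⊕ Fin 2} (hxy : (truncate G v q r).Adj x y)
      (hx : x = .inl v ∨ x = .inr 0 ∨ x = .inr 1) : s(x, y) = s(.inl v, .inl p) ∨
        s(x, y) = s(.inl v, .inr 0) ∨ s(x, y) = s(.inl v, .inr 1) ∨ s(x, y) = s(.inr 0, .inr 1) ∨
        s(x, y) = s(.inr 0, .inl q) ∨ s(x, y) = s(.inr 1, .inl r) := by
    obtain rfl | rfl | rfl := hx
    · obtain rfl | rfl | rfl := (h.truncate_inl.adj_iff y).1 hxy <;> simp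
    · obtain rfl | rfl | rfl := (h.truncate_inr_zero.adj_iff y).1 hxy <;> simp [Sym2.eq_swap]
    · obtain rfl | rfl | rfl := (h.truncate_inr_one.adj_iff y).1 hxy <;> simp [Sym2.eq_swap]
  have hcases (x : V ⊕ Fin 2) :
      (∃ a, x = .inl a ∧ v ≠ a) ∨ x = .inl v ∨ x = .inr 0 ∨ x = .inr 1 := by
    rcases x with a | i
    · by_cases ha : v = a <;> simp [ha]
    · fin_cases i <;> simp
  induction e' with | _ x y
  obtain ⟨a, rfl, ha⟩ | hx := hcases x
  · obtain ⟨b, rfl, hb⟩ | hy := hcases y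
    · exact .inl ⟨s(a, b), (truncate_adj_inl_inl.1 he').1, by simp [ha, hb], rfl⟩
    · rw [Sym2.eq_swap]
      exact .inr (hcorner (SimpleGraph.Adj.symm he') hy)
  · exact .inr (hcorner he' hx)

lemma exists_edge_liftMating_mem_matingsThrough (h : HasNeighbors G v p q r)
    {e' : Sym2 (V ⊕ Fin 2)} (he' : e' ∈ (truncate G v q r).edgeSet) :
    ∃ e ∈ G.edgeSet, (v ∉ e → e' = e.map .inl) ∧
      (e = s(v, r) → e' = s(.inl v, .inr 0) ∨ e' = s(.inr 1, .inl r)) ∧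
      ∀ f ∈ matingsThrough G ∅ e, liftMating v q r f ∈ matingsThrough (truncate G v q r) ∅ e' := by
  have := h.ne_left
  have h₁₂ := h.ne₁₂
  have h₁₃ := h.ne₁₃
  have h₂₃ := h.ne₂₃
  have hlift (w : V) (x y : V ⊕ Fin 2) (hw : w = p ∨ w = q ∨ w = r)
      (hwr : w = r → s(x, y) = s(.inl v, .inr 0) ∨ s(x, y) = s(.inr 1, .inl r))
      (hxy : ∀ f : V → V, f v = w → liftMating v q r f x = y) :
      ∃ e ∈ G.edgeSet, (v ∉ e → s(x, y) = e.map .inl) ∧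
        (e = s(v, r) → s(x, y) = s(.inl v, .inr 0) ∨ s(x, y) = s(.inr 1, .inl r)) ∧
        ∀ f ∈ matingsThrough G ∅ e,
          liftMating v q r f ∈ matingsThrough (truncate G v q r) ∅ s(x, y) := by
    refine ⟨s(v, w), (h.adj_iff w).2 hw, by simp, fun he => hwr (Sym2.congr_right.1 he),
      fun f hf => ?_⟩
    obtain ⟨hf, -, hfw⟩ := mem_matingsThrough_mk.1 hf
    exact mem_matingsThrough_mk.2 ⟨hf.lift h, by simp, hxy f hfw⟩
  obtain ⟨e, he, hve, rfl⟩ | rfl | rfl | rfl | rfl | rfl | rfl := h.mem_edgeSet_truncate he'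
  · refine ⟨e, he, fun _ => rfl, by rintro rfl; simp at hve, fun f hf => ?_⟩
    induction e with | _ a b
    simp only [Sym2.mem_iff, not_or] at hve
    obtain ⟨hmating, -, rfl⟩ := mem_matingsThrough_mk.1 hf
    exact mem_matingsThrough_mk.2
      ⟨hmating.lift h, by simp, liftMating_inl (Ne.symm hve.1) (Ne.symm hve.2)⟩
  · exact hlift p (.inl v) (.inl p) (by simp) (absurd · h₁₃) fun f hf => by grind [liftMating]
  · exact hlift r (.inl v) (.inr 0) (by simp) (by simp) fun f hf => by grind [liftMating]
  · exact hlift q (.inl v) (.inr 1) (by simp) (absurd · h₂₃) fun f hf => by grind [liftMating]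
  · exact hlift p (.inr 0) (.inr 1) (by simp) (absurd · h₁₃) fun f hf => by grind [liftMating]
  · exact hlift q (.inr 0) (.inl q) (by simp) (absurd · h₂₃) fun f hf => by grind [liftMating]
  · exact hlift r (.inr 1) (.inl r) (by simp) (by simp)
      fun f hf => by grind [liftMating]

lemma injOn_liftMating (h : HasNeighbors G v p q r) :
    Set.InjOn (liftMating v q r) (matingsThrough G ∅ e) :=
  Set.LeftInvOn.injOn fun _ hf => hf.1.lowerMating_liftMating h

protected lemma IsDoubleCoveredOff.truncate {E : Set (Sym2 V)} (hE : IsDoubleCoveredOff G E)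
    (h : HasNeighbors G v p q r) (hv : ∀ e ∈ E, v ∉ e) :
    IsDoubleCoveredOff (truncate G v q r) (Sym2.map .inl '' E) := by
  intro e' he' hnot
  obtain ⟨e, he, hmap, -, hlift⟩ := exists_edge_liftMating_mem_matingsThrough h he'
  have heE : e ∉ E := fun heE => hnot ⟨e, heE, (hmap (hv e heE)).symm⟩
  exact ((hE e he heE).image_of_injOn (injOn_liftMating h)).mono (Set.image_subset_iff.2 hlift)

lemma nontrivial_matingsThrough_truncate_inl_inr_one (h : HasNeighbors G v p q r) {f t : V → V}
    (hf : IsMating G ∅ f) (hfr : f v = r) (ht : IsMating G (closedNeighborSet G v) t) :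
    (matingsThrough (truncate G v q r) ∅ s(.inr 1, .inl r)).Nontrivial := by
  classical
  obtain ⟨hg, hq₀, hr₁⟩ := (isMating_truncate_iff_exists_tripod h).2 ⟨t, ht, rfl⟩
  refine ⟨_, mem_matingsThrough_mk.2 ⟨hf.lift h, by simp, ?_⟩,
    _, mem_matingsThrough_mk.2 ⟨hg, by simp, hr₁⟩, fun heq => ?_⟩
  · simp [liftMating, hfr]
  · rw [← heq] at hq₀
    simp [liftMating, hfr, h.ne₂₃.symm, h.ne_left.2.1] at hq₀

lemma IsDoubleCoveredOff.truncate_insert {E : Set (Sym2 V)} {f t : V → V}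
    (hE : IsDoubleCoveredOff G (insert s(v, r) E))
    (h : HasNeighbors G v p q r) (hv : ∀ e ∈ E, v ∉ e)
    (hf : IsMating G ∅ f) (hfr : f v = r) (ht : IsMating G (closedNeighborSet G v) t) :
    IsDoubleCoveredOff (truncate G v q r)
      (insert s(.inl v, .inr 0) (Sym2.map .inl '' E)) := by
  intro e' he' hnot
  rw [Set.mem_insert_iff, not_or] at hnot
  obtain ⟨e, he, hmap, hr, hlift⟩ := exists_edge_liftMating_mem_matingsThrough h he'
  rcases eq_or_ne e s(v, r) with rfl | her
  · rw [(hr rfl).resolve_left hnot.1]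
    exact nontrivial_matingsThrough_truncate_inl_inr_one h hf hfr ht
  · have heE : e ∉ E := fun heE => hnot.2 ⟨e, heE, (hmap (hv e heE)).symm⟩
    exact ((hE e he (by simp [her, heE])).image_of_injOn (injOn_liftMating h)).mono
      (Set.image_subset_iff.2 hlift)

end Lonely

section Patterns

variable {V : Type*} {G : SimpleGraph V} {v p q r : V} {e : Sym2 V} {F : Set (Sym2 V)}

lemma exists_apply_eq_of_mem_matingsThrough_truncate (h : HasNeighbors G v p q r)
    {t : V ⊕ Fin 2 → V ⊕ Fin 2} (ht : t ∈ matingsThrough (truncate G v q r)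
      (closedNeighborSet (truncate G v q r) (.inr 1)) (e.map .inl)) :
    ∃ f ∈ matingsThrough G ∅ e, f v = r := by
  obtain ⟨f, hf, rfl⟩ := exists_isMating_eq_map_of_truncate h ht.1
  refine exists_mem_matingsThrough_apply_eq ((h.adj_iff r).2 (by simp)) (t := f) ?_
  induction e with | _ a b
  obtain ⟨-, ha, hab⟩ := mem_matingsThrough_mk.1 ht
  refine mem_matingsThrough_mk.2 ⟨hf, ?_, by simpa using hab⟩
  simpa [h.truncate_inr_one.closedNeighborSet_eq, or_comm] using ha

lemma exists_apply_eq_of_mem_matingsThrough_truncateTwice (h : HasNeighbors G v p q r)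
    {t : (V ⊕ Fin 2) ⊕ Fin 2 → (V ⊕ Fin 2) ⊕ Fin 2} (ht : t ∈ matingsThrough
      (truncateTwice G v q r)
      (closedNeighborSet (truncateTwice G v q r) (.inl (.inl v)))
      ((e.map .inl).map .inl)) :
    ∃ f ∈ matingsThrough G ∅ e, f v = p := by
  classical
  obtain ⟨f, hf, rfl⟩ := (isMating_truncateTwice_iff h).1 ht.1
  refine exists_mem_matingsThrough_apply_eq ((h.adj_iff p).2 (by simp)) (t := f) ?_
  induction e with | _ a b
  obtain ⟨-, ha, hab⟩ := mem_matingsThrough_mk.1 ht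
  refine mem_matingsThrough_mk.2 ⟨hf, ?_, ?_⟩
  · simpa [h.closedNeighborSet_truncateTwice] using ha
  · simpa [Equiv.swap_apply_of_ne_of_ne] using hab

/-- The part of the induction hypothesis that concerns matchings: `s(v, r)` and the edges of `F` are
lonely, all other edges are double covered, and the perfect matching through an edge of `F` uses
`s(v, q)`. The last property is what keeps the edges of `F` lonely after the next step. A tripod is
a matching that covers every vertex except that `v` is incident with three of its edges; it is
encoded by a perfect matching of the graph without the closed neighbourhood of `v`. -/
structure IsLonelyPattern (G : SimpleGraph V) (v p q r : V) (F : Set (Sym2 V)) : Prop where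
  hasNeighbors : HasNeighbors G v p q r
  spoke : ∃ f, matingsThrough G ∅ s(v, r) = {f}
  notMem : ∀ e ∈ F, v ∉ e
  unique : ∀ e ∈ F, ∃ f, matingsThrough G ∅ e = {f} ∧ f v = q
  tripod : ∃ t, IsMating G (closedNeighborSet G v) t
  tripodThrough : ∀ e ∈ F, matingsThrough G (closedNeighborSet G v) e = ∅
  doubleCoveredOff : IsDoubleCoveredOff G (insert s(v, r) F)

lemma HasNeighbors.exists_tripod_truncateTwice (h : HasNeighbors G v p q r) {f : V → V}
    (hf : IsMating G ∅ f) (hfp : f v = p) :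
    ∃ t, IsMating (truncateTwice G v q r)
      (closedNeighborSet (truncateTwice G v q r) (.inl (.inl v)))
      t := by
  classical
  exact ⟨_, (isMating_truncateTwice_iff h).2
    ⟨_, insert_empty_eq (β := Set V) p ▸ hf.removeEdge hfp, rfl⟩⟩

namespace IsLonelyPattern

lemma matingsThrough_truncateTwice_spoke (h : IsLonelyPattern G v p q r F) :
    ∃ f, matingsThrough (truncateTwice G v q r) ∅
      s(.inl (.inl v), .inl (.inr 0)) = {f} := by
  obtain ⟨f, hf⟩ := h.spoke
  have hH := h.hasNeighbors.truncate_inr_one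
  refine ⟨liftMating (.inr 1) (.inl v) (.inr 0) (liftMating v q r f), ?_⟩
  rw [← Sym2.map_mk, matingsThrough_truncate hH (by simp),
    matingsThrough_truncate_inl_inr_zero h.hasNeighbors, hf, Set.image_singleton,
    Set.image_singleton]
  refine Set.eq_empty_of_forall_notMem fun t ht => (mem_matingsThrough_mk.1 ht).2.1 ?_
  simp [hH.closedNeighborSet_eq]

lemma matingsThrough_truncateTwice (h : IsLonelyPattern G v p q r F) (he : e ∈ F) :
    ∃ f, matingsThrough (truncateTwice G v q r) ∅
      ((e.map .inl).map .inl) = {f} ∧ f (.inl (.inl v)) = .inr 0 := by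
  obtain ⟨f, hf, hfq⟩ := h.unique e he
  refine ⟨liftMating (.inr 1) (.inl v) (.inr 0) (liftMating v q r f), ?_, ?_⟩
  · rw [matingsThrough_truncate h.hasNeighbors.truncate_inr_one (by simp),
      matingsThrough_truncate h.hasNeighbors (h.notMem e he) (h.tripodThrough e he),
      hf, Set.image_singleton, Set.image_singleton]
    refine Set.eq_empty_of_forall_notMem fun t ht => ?_
    obtain ⟨g, hg, hgr⟩ := exists_apply_eq_of_mem_matingsThrough_truncate h.hasNeighbors ht
    rw [hf, Set.mem_singleton_iff] at hg
    exact h.hasNeighbors.ne₂₃ (hfq.symm.trans (hg ▸ hgr))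
  · simp [liftMating, hfq, corner]

lemma tripodThrough_truncateTwice (h : IsLonelyPattern G v p q r F) (he : e ∈ F) :
    matingsThrough (truncateTwice G v q r)
      (closedNeighborSet (truncateTwice G v q r) (.inl (.inl v)))
      ((e.map .inl).map .inl) = ∅ := by
  refine Set.eq_empty_of_forall_notMem fun t ht => ?_
  obtain ⟨f, hf, hfq⟩ := h.unique e he
  obtain ⟨g, hg, hgp⟩ := exists_apply_eq_of_mem_matingsThrough_truncateTwice h.hasNeighbors ht
  rw [hf, Set.mem_singleton_iff] at hg
  exact h.hasNeighbors.ne₁₂ (hgp.symm.trans (hg ▸ hfq))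

lemma doubleCoveredOff_truncateTwice (h : IsLonelyPattern G v p q r F) :
    IsDoubleCoveredOff (truncateTwice G v q r)
      (insert s(.inl (.inl v), .inl (.inr 0)) (Sym2.map .inl '' (Sym2.map .inl '' F))) := by
  obtain ⟨f, hf⟩ := h.spoke
  obtain ⟨t, ht⟩ := h.tripod
  obtain ⟨hfmating, -, hfr⟩ := mem_matingsThrough_mk.1 (hf.symm.subset rfl)
  have hH := h.doubleCoveredOff.truncate_insert h.hasNeighbors h.notMem hfmating hfr ht
  rw [← Sym2.map_mk, ← Set.image_insert_eq]
  exact hH.truncate h.hasNeighbors.truncate_inr_one (by simp)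

lemma exists_apply_eq (h : IsLonelyPattern G v p q r F) : ∃ f, IsMating G ∅ f ∧ f v = p := by
  have hp : s(v, p) ∈ G.edgeSet := (h.hasNeighbors.adj_iff p).2 (by simp)
  have hnot : s(v, p) ∉ insert s(v, r) F := by
    rintro (he | he)
    · exact h.hasNeighbors.ne₁₃ (Sym2.congr_right.1 he)
    · exact h.notMem _ he (Sym2.mem_mk_left v p)
  obtain ⟨f, hf⟩ := (h.doubleCoveredOff _ hp hnot).nonempty
  obtain ⟨hf, -, hfp⟩ := mem_matingsThrough_mk.1 hf
  exact ⟨f, hf, hfp⟩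

protected lemma truncateTwice (h : IsLonelyPattern G v p q r F) :
    IsLonelyPattern (truncateTwice G v q r) (.inl (.inl v))
      (.inl (.inl p)) (.inr 0) (.inl (.inr 0)) (Sym2.map .inl '' (Sym2.map .inl '' F)) where
  hasNeighbors := h.hasNeighbors.truncateTwice
  spoke := h.matingsThrough_truncateTwice_spoke
  notMem := by simpa using h.notMem
  unique := by simpa using fun e => h.matingsThrough_truncateTwice
  tripod := by
    obtain ⟨f, hf, hfp⟩ := h.exists_apply_eq
    exact h.hasNeighbors.exists_tripod_truncateTwice hf hfp
  tripodThrough := by simpa using fun e => h.tripodThrough_truncateTwice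
  doubleCoveredOff := h.doubleCoveredOff_truncateTwice

end IsLonelyPattern

end Patterns

section Cubic

variable {V : Type*} {G : SimpleGraph V} {v p q r : V}

lemma isRegularOfDegree_three_iff [G.LocallyFinite] :
    G.IsRegularOfDegree 3 ↔ ∀ w, ∃ a b c, HasNeighbors G w a b c := by
  classical
  refine forall_congr' fun w => ?_
  rw [← SimpleGraph.card_neighborFinset_eq_degree, Finset.card_eq_three]
  refine exists_congr fun a => exists_congr fun b => exists_congr fun c => ?_
  simp only [Finset.ext_iff, SimpleGraph.mem_neighborFinset, Finset.mem_insert,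
    Finset.mem_singleton]
  exact ⟨fun ⟨hab, hac, hbc, h⟩ => ⟨h, hab, hac, hbc⟩, fun ⟨h, hab, hac, hbc⟩ => ⟨hab, hac, hbc, h⟩⟩

lemma HasNeighbors.exists_hasNeighbors_truncate (h : HasNeighbors G v p q r)
    (hG : ∀ w, ∃ a b c, HasNeighbors G w a b c) (x : V ⊕ Fin 2) :
    ∃ a b c, HasNeighbors (truncate G v q r) x a b c := by
  rcases x with w | i
  · rcases eq_or_ne w v with rfl | hw
    · exact ⟨_, _, _, h.truncate_inl⟩
    · obtain ⟨a, b, c, hwn⟩ := hG w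
      exact ⟨_, _, _, h.truncate_of_ne hw hwn⟩
  · fin_cases i
    · exact ⟨_, _, _, h.truncate_inr_zero⟩
    · exact ⟨_, _, _, h.truncate_inr_one⟩

lemma HasNeighbors.eq_of_truncate_triangle [DecidableEq V] (h : HasNeighbors G v p q r)
    {x y z : V ⊕ Fin 2} (hx : x = .inl v ∨ x = .inr 0 ∨ x = .inr 1)
    (hxy : (truncate G v q r).Adj x y) (hxz : (truncate G v q r).Adj x z)
    (hyz : (truncate G v q r).Adj y z) :
    ({x, y, z} : Finset (V ⊕ Fin 2)) = {.inl v, .inr 0, .inr 1} := by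
  have := h.ne_left
  have h₂₃ := h.ne₂₃
  have h₁₂ := h.ne₁₂
  have h₁₃ := h.ne₁₃
  have hl := h.truncate_inl.adj_iff
  have h₀ := h.truncate_inr_zero.adj_iff
  have h₁ := h.truncate_inr_one.adj_iff
  have hne := hyz.ne
  have hzy := hyz.symm
  rw [Finset.ext_iff]
  grind

lemma cliqueSet_truncate [DecidableEq V] (h : HasNeighbors G v p q r) :
    (truncate G v q r).cliqueSet 3 = insert {.inl v, .inr 0, .inr 1}
      (Finset.map .inl '' {s ∈ G.cliqueSet 3 | v ∉ s}) := by
  have := h.ne_left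
  ext s
  simp only [SimpleGraph.mem_cliqueSet_iff, Set.mem_insert_iff, Set.mem_image, Set.mem_ofPred_eq,
    SimpleGraph.is3Clique_iff]
  constructor
  · rintro ⟨x, y, z, hxy, hxz, hyz, rfl⟩
    have hout (x : V ⊕ Fin 2) (hx : ¬(x = .inl v ∨ x = .inr 0 ∨ x = .inr 1)) :
        ∃ a ≠ v, x = .inl a := by
      rcases x with a | i
      · exact ⟨a, by simpa using hx, rfl⟩
      · fin_cases i <;> simp at hx
    by_cases hx : x = .inl v ∨ x = .inr 0 ∨ x = .inr 1
    · exact .inl (h.eq_of_truncate_triangle hx hxy hxz hyz)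
    by_cases hy : y = .inl v ∨ y = .inr 0 ∨ y = .inr 1
    · exact .inl (by rw [← h.eq_of_truncate_triangle hy hxy.symm hyz hxz]; grind)
    by_cases hz : z = .inl v ∨ z = .inr 0 ∨ z = .inr 1
    · exact .inl (by rw [← h.eq_of_truncate_triangle hz hxz.symm hyz.symm hxy]; grind)
    obtain ⟨a, ha, rfl⟩ := hout x hx
    obtain ⟨b, hb, rfl⟩ := hout y hy
    obtain ⟨c, hc, rfl⟩ := hout z hz
    refine .inr ⟨{a, b, c}, ⟨⟨a, b, c, (truncate_adj_inl_inl.1 hxy).1,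
      (truncate_adj_inl_inl.1 hxz).1, (truncate_adj_inl_inl.1 hyz).1, rfl⟩, ?_⟩, by simp⟩
    simp [ha.symm, hb.symm, hc.symm]
  · rintro (rfl | ⟨s, ⟨⟨a, b, c, hab, hac, hbc, rfl⟩, hv⟩, rfl⟩)
    · exact ⟨_, _, _, by simp, by simp, by simp, rfl⟩
    · simp only [Finset.mem_insert, Finset.mem_singleton, not_or] at hv
      exact ⟨.inl a, .inl b, .inl c, by grind [truncate_adj_inl_inl],
        by grind [truncate_adj_inl_inl], by grind [truncate_adj_inl_inl], by simp⟩

end Cubic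

section Triangles

variable {V : Type*} {G : SimpleGraph V} {v p q r : V}

lemma HasNeighbors.cliqueSet_truncateTwice [DecidableEq V] (h : HasNeighbors G v p q r)
    (hv : ∀ s ∈ G.cliqueSet 3, v ∉ s) :
    (truncateTwice G v q r).cliqueSet 3 =
      insert {.inl (.inr 1), .inr 0, .inr 1}
        (Finset.map .inl '' (Finset.map .inl '' G.cliqueSet 3)) := by
  rw [cliqueSet_truncate h.truncate_inr_one, cliqueSet_truncate h]
  congr 2
  ext s
  simp only [Set.mem_ofPred_eq, Set.mem_insert_iff, Set.mem_image]
  constructor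
  · rintro ⟨rfl | ⟨t, ht, rfl⟩, hs⟩
    · simp at hs
    · exact ⟨t, ht.1, rfl⟩
  · rintro ⟨t, ht, rfl⟩
    exact ⟨.inr ⟨t, ⟨ht, hv t ht⟩, rfl⟩, by simp⟩

lemma HasNeighbors.ncard_cliqueSet_truncateTwice [Finite V] (h : HasNeighbors G v p q r)
    (hv : ∀ s ∈ G.cliqueSet 3, v ∉ s) :
    ((truncateTwice G v q r).cliqueSet 3).ncard =
      (G.cliqueSet 3).ncard + 1 := by
  classical
  rw [h.cliqueSet_truncateTwice hv, Set.ncard_insert_of_notMem,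
    Set.ncard_image_of_injective _ (Finset.map_injective _),
    Set.ncard_image_of_injective _ (Finset.map_injective _)]
  rintro ⟨s, -, hs⟩
  have : .inr 0 ∈ s.map (.inl : V ⊕ Fin 2 ↪ (V ⊕ Fin 2) ⊕ Fin 2) := by simp [hs]
  simp at this

lemma HasNeighbors.notMem_triangle_truncateTwice (h : HasNeighbors G v p q r)
    (hv : ∀ s ∈ G.cliqueSet 3, v ∉ s) :
    ∀ s ∈ (truncateTwice G v q r).cliqueSet 3,
      .inl (.inl v) ∉ s := by
  classical
  rw [h.cliqueSet_truncateTwice hv]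
  rintro s (rfl | ⟨-, ⟨s, hs, rfl⟩, rfl⟩)
  · simp
  · simpa using hv s hs

end Triangles

section Connectivity

variable {V : Type*} {G : SimpleGraph V} {v p q r : V}

/-- Outside `S`, the set `C` is a union of connected components of `G - S`. -/
def IsComponentUnion (G : SimpleGraph V) (S : Finset V) (C : Set V) : Prop :=
  ∀ a ∉ S, ∀ b ∉ S, G.Adj a b → (a ∈ C ↔ b ∈ C)

lemma isVertexConnected_iff [Fintype V] {k : ℕ} :
    IsVertexConnected G k ↔ k < Fintype.card V ∧ ∀ S : Finset V, S.card < k →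
      ∀ C, IsComponentUnion G S C → ∀ a ∉ S, ∀ b ∉ S, (a ∈ C ↔ b ∈ C) := by
  refine and_congr_right fun hk => forall₂_congr fun S hS => ?_
  constructor
  · intro hconn C hC a ha b hb
    have hwalk (x y : {v : V | v ∉ S}) (w : (G.induce {v : V | v ∉ S}).Walk x y) :
        (x : V) ∈ C ↔ (y : V) ∈ C := by
      induction w with
      | nil => rfl
      | @cons a b _ hadj _ ih => exact (hC a a.2 b b.2 hadj).trans ih
    exact (hconn.preconnected ⟨a, ha⟩ ⟨b, hb⟩).elim (hwalk _ _)
  · intro hcut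
    obtain ⟨a, ha⟩ : ∃ a, a ∉ S := by
      by_contra! hall
      exact (hS.trans hk).ne (by rw [Finset.eq_univ_of_forall hall, Finset.card_univ])
    refine (SimpleGraph.connected_iff_exists_forall_reachable _).2 ⟨⟨a, ha⟩, fun ⟨b, hb⟩ => ?_⟩
    let C : Set V := {b | ∃ hb, (G.induce {v : V | v ∉ S}).Reachable ⟨a, ha⟩ ⟨b, hb⟩}
    have hC : IsComponentUnion G S C := fun x hx y hy hxy => by
      have hreach : (G.induce {v : V | v ∉ S}).Reachable ⟨x, hx⟩ ⟨y, hy⟩ :=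
        SimpleGraph.Adj.reachable hxy
      exact ⟨fun ⟨_, h⟩ => ⟨hy, h.trans hreach⟩, fun ⟨_, h⟩ => ⟨hx, h.trans hreach.symm⟩⟩
    exact ((hcut C hC a ha b hb).1 ⟨ha, .rfl⟩).2

lemma exists_notMem_mem_iff_mem {S : Finset V} {C : Set V} (hC : IsComponentUnion G S C)
    (hS : S.card < 3) {x y z a b : V} (hx : x ∉ S) (hy : y ∈ S) (hxz : G.Adj x z) (hxa : G.Adj x a)
    (hzb : G.Adj z b) (hyz : y ≠ z) (hya : y ≠ a) (hyb : y ≠ b) (hza : z ≠ a) (hab : a ≠ b) :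
    ∃ c, (c = a ∨ c = b) ∧ c ∉ S ∧ (c ∈ C ↔ x ∈ C) := by
  classical
  by_cases ha : a ∈ S
  · have hSya : ∀ w ∈ S, w = y ∨ w = a := by
      intro w hw
      by_contra! hne
      have : ({w, y, a} : Finset V) ⊆ S := by grind
      have := Finset.card_le_card this
      rw [Finset.card_eq_three.2 ⟨w, y, a, hne.1, hne.2, hya, rfl⟩] at this
      lia
    have hz : z ∉ S := fun hz => by grind
    have hb : b ∉ S := fun hb => by grind
    exact ⟨b, .inr rfl, hb, ((hC x hx z hz hxz).trans (hC z hz b hb hzb)).symm⟩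
  · exact ⟨a, .inl rfl, ha, (hC x hx a ha hxa).symm⟩

lemma HasNeighbors.exists_eq_corner (h : HasNeighbors G v p q r) {x : V ⊕ Fin 2}
    (hx : contract v x = v) : ∃ w, G.Adj v w ∧ x = corner v q r w := by
  have h₁₂ := h.ne₁₂
  have h₁₃ := h.ne₁₃
  have h₂₃ := h.ne₂₃
  rcases x with a | i
  · obtain rfl : a = v := hx
    exact ⟨p, (h.adj_iff p).2 (by simp), by simp [corner, h₁₂, h₁₃]⟩
  · fin_cases i
    · exact ⟨q, (h.adj_iff q).2 (by simp), by simp [corner]⟩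
    · exact ⟨r, (h.adj_iff r).2 (by simp), by simp [corner, h₂₃.symm]⟩

lemma HasNeighbors.truncate_adj_corner (h : HasNeighbors G v p q r) {w : V} (hw : G.Adj v w) :
    (truncate G v q r).Adj (corner v q r w) (.inl w) := by
  have hp := (h.truncate_inl.adj_iff (.inl p)).2 (by simp)
  have hq := (h.truncate_inr_zero.adj_iff (.inl q)).2 (by simp)
  have hr := (h.truncate_inr_one.adj_iff (.inl r)).2 (by simp)
  rw [h.adj_iff] at hw
  have h₁₂ := h.ne₁₂
  have h₁₃ := h.ne₁₃
  grind [corner]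

lemma HasNeighbors.truncate_adj_corner_corner (h : HasNeighbors G v p q r) {w w' : V}
    (hw : G.Adj v w) (hw' : G.Adj v w') (hne : w ≠ w') :
    (truncate G v q r).Adj (corner v q r w) (corner v q r w') := by
  rw [h.adj_iff] at hw hw'
  grind [corner, truncate_adj_inl_inr, truncate_adj_inr_inl, truncate_adj_inr_inr]

lemma corner_ne_inl {w a : V} (ha : v ≠ a) : corner v q r w ≠ .inl a := by
  grind [corner]

lemma mem_image_contract_iff [DecidableEq V] {S : Finset (V ⊕ Fin 2)} {a : V} (ha : a ≠ v) :
    a ∈ S.image (contract v) ↔ .inl a ∈ S := by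
  rw [Finset.mem_image]
  refine ⟨?_, fun hS => ⟨_, hS, rfl⟩⟩
  rintro ⟨b | i, hS, hb⟩
  · rwa [← show b = a from hb]
  · exact absurd hb.symm ha

lemma HasNeighbors.exists_inl_notMem_of_corner (h : HasNeighbors G v p q r)
    {S : Finset (V ⊕ Fin 2)} (hS : S.card < 3) {C : Set (V ⊕ Fin 2)}
    (hC : IsComponentUnion (truncate G v q r) S C) {x y : V ⊕ Fin 2} (hx : x ∉ S) (hy : y ∈ S)
    (hxv : contract v x = v) (hyv : contract v y = v) :
    ∃ a, a ≠ v ∧ .inl a ∉ S ∧ (.inl a ∈ C ↔ x ∈ C) := by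
  obtain ⟨w₁, hw₁, rfl⟩ := h.exists_eq_corner hxv
  obtain ⟨w₂, hw₂, rfl⟩ := h.exists_eq_corner hyv
  have : w₁ ≠ w₂ := by
    rintro rfl
    exact hx hy
  obtain ⟨w₃, hw₃, h₁₃, h₂₃⟩ : ∃ w₃, G.Adj v w₃ ∧ w₁ ≠ w₃ ∧ w₂ ≠ w₃ := by
    obtain ⟨hadj, hpq, hpr, hqr⟩ := h
    have hp := (hadj p).2 (.inl rfl)
    have hq := (hadj q).2 (.inr (.inl rfl))
    have hr := (hadj r).2 (.inr (.inr rfl))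
    grind
  obtain ⟨c, hc, hcS, hcC⟩ := exists_notMem_mem_iff_mem hC hS hx hy
    (h.truncate_adj_corner_corner hw₁ hw₃ h₁₃) (h.truncate_adj_corner hw₁)
    (h.truncate_adj_corner hw₃) (h.truncate_adj_corner_corner hw₂ hw₃ h₂₃).ne
    (corner_ne_inl hw₁.ne) (corner_ne_inl hw₃.ne) (corner_ne_inl hw₁.ne)
    (Sum.inl_injective.ne h₁₃)
  obtain rfl | rfl := hc
  · exact ⟨w₁, hw₁.ne', hcS, hcC⟩
  · exact ⟨w₃, hw₃.ne', hcS, hcC⟩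

lemma HasNeighbors.exists_notMem_image_contract [DecidableEq V] (h : HasNeighbors G v p q r)
    {S : Finset (V ⊕ Fin 2)} (hS : S.card < 3) {C : Set (V ⊕ Fin 2)}
    (hC : IsComponentUnion (truncate G v q r) S C) {x : V ⊕ Fin 2} (hx : x ∉ S) :
    ∃ a ∉ S.image (contract v), (.inl a ∈ C ↔ x ∈ C) := by
  by_cases hxv : contract v x = v
  · by_cases hv : v ∈ S.image (contract v)
    · obtain ⟨y, hy, hyv⟩ := Finset.mem_image.1 hv
      obtain ⟨a, hav, ha, haC⟩ := h.exists_inl_notMem_of_corner hS hC hx hy hxv hyv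
      exact ⟨a, (mem_image_contract_iff hav).not.2 ha, haC⟩
    · refine ⟨v, hv, ?_⟩
      rcases x with a | i
      · rw [show a = v from hxv]
      · exact hC _ (fun hS => hv (Finset.mem_image.2 ⟨_, hS, rfl⟩)) _ hx (by simp)
  · rcases x with a | i
    · exact ⟨a, (mem_image_contract_iff hxv).not.2 hx, .rfl⟩
    · exact absurd rfl hxv

lemma HasNeighbors.isComponentUnion_preimage_inl [DecidableEq V] (h : HasNeighbors G v p q r)
    {S : Finset (V ⊕ Fin 2)} {C : Set (V ⊕ Fin 2)}
    (hC : IsComponentUnion (truncate G v q r) S C) :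
    IsComponentUnion G (S.image (contract v)) (.inl ⁻¹' C) := by
  have hinl {a : V} (ha : a ∉ S.image (contract v)) : .inl a ∉ S :=
    fun hS => ha (Finset.mem_image.2 ⟨_, hS, rfl⟩)
  have hinr (i : Fin 2) (hv : v ∉ S.image (contract v)) : .inr i ∉ S :=
    fun hS => hv (Finset.mem_image.2 ⟨_, hS, rfl⟩)
  have hspoke (w : V) (hv : v ∉ S.image (contract v)) (hw : w ∉ S.image (contract v))
      (hvw : G.Adj v w) : .inl v ∈ C ↔ .inl w ∈ C := by
    obtain rfl | rfl | rfl := (h.adj_iff w).1 hvw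
    · exact hC _ (hinl hv) _ (hinl hw) (by simp [h.truncate_inl.adj_iff])
    · exact (hC _ (hinl hv) (.inr 0) (hinr 0 hv) (by simp)).trans
        (hC _ (hinr _ hv) _ (hinl hw) (by simp))
    · exact (hC _ (hinl hv) (.inr 1) (hinr 1 hv) (by simp)).trans
        (hC _ (hinr _ hv) _ (hinl hw) (by simp))
  intro a ha b hb hab
  rcases eq_or_ne a v with rfl | hav
  · exact hspoke b ha hb hab
  rcases eq_or_ne b v with rfl | hbv
  · exact (hspoke a hb ha hab.symm).symm
  · exact hC _ (hinl ha) _ (hinl hb) (by simp [hab, hav, hbv])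

lemma HasNeighbors.isVertexConnected_truncate [Fintype V] (h : HasNeighbors G v p q r)
    (hG : IsVertexConnected G 3) : IsVertexConnected (truncate G v q r) 3 := by
  classical
  obtain ⟨hcard, hcut⟩ := isVertexConnected_iff.1 hG
  refine isVertexConnected_iff.2 ⟨by simp; lia, fun S hS C hC x hx y hy => ?_⟩
  obtain ⟨a, ha, hax⟩ := h.exists_notMem_image_contract hS hC hx
  obtain ⟨b, hb, hby⟩ := h.exists_notMem_image_contract hS hC hy
  rw [← hax, ← hby]
  exact hcut _ (Finset.card_image_le.trans_lt hS) _ (h.isComponentUnion_preimage_inl hC) a ha b hb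

end Connectivity

section Seeds

variable {V : Type*} {G : SimpleGraph V} {v p q r : V} {F : Set (Sym2 V)}

lemma IsLonelyPattern.lonelyEdges_eq (h : IsLonelyPattern G v p q r F) :
    lonelyEdges G = insert s(v, r) F := by
  ext e
  rw [mem_lonelyEdges_iff]
  constructor
  · rintro ⟨f, hf⟩
    by_contra he
    have hedge : e ∈ G.edgeSet := mem_edgeSet_of_mem_matingsThrough (hf.symm.subset rfl)
    exact (h.doubleCoveredOff e hedge he).ne_singleton hf
  · rintro (rfl | he)
    · exact h.spoke
    · obtain ⟨f, hf, -⟩ := h.unique e he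
      exact ⟨f, hf⟩

lemma IsLonelyPattern.ncard_lonelyEdges [Finite V] (h : IsLonelyPattern G v p q r F) :
    (lonelyEdges G).ncard = F.ncard + 1 := by
  rw [h.lonelyEdges_eq, Set.ncard_insert_of_notMem fun he => h.notMem _ he (Sym2.mem_mk_left v r)]

/-- A `3`-connected cubic graph with a lonely pattern at a vertex `v` that lies in no triangle: the
induction hypothesis of the construction. -/
structure IsSeed [Fintype V] (G : SimpleGraph V) (v p q r : V) (F : Set (Sym2 V)) : Prop
    extends IsLonelyPattern G v p q r F where
  cubic : ∀ w, ∃ a b c, HasNeighbors G w a b c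
  isVertexConnected : IsVertexConnected G 3
  notMem_triangle : ∀ s ∈ G.cliqueSet 3, v ∉ s

namespace IsSeed

protected lemma truncateTwice [Fintype V] (h : IsSeed G v p q r F) :
    IsSeed (truncateTwice G v q r) (.inl (.inl v))
      (.inl (.inl p)) (.inr 0) (.inl (.inr 0)) (Sym2.map .inl '' (Sym2.map .inl '' F)) where
  toIsLonelyPattern := h.toIsLonelyPattern.truncateTwice
  cubic := h.hasNeighbors.truncate_inr_one.exists_hasNeighbors_truncate
    (h.hasNeighbors.exists_hasNeighbors_truncate h.cubic)
  isVertexConnected := h.hasNeighbors.truncate_inr_one.isVertexConnected_truncate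
    (h.hasNeighbors.isVertexConnected_truncate h.isVertexConnected)
  notMem_triangle := h.hasNeighbors.notMem_triangle_truncateTwice h.notMem_triangle

lemma inUWith [Fintype V] [DecidableRel G.Adj] (h : IsSeed G v p q r F) :
    InUWith G (F.ncard + 1) := by
  refine ⟨⟨?_, h.isVertexConnected, ?_⟩, h.ncard_lonelyEdges⟩
  · exact isRegularOfDegree_three_iff.2 h.cubic
  · refine not_isMatchingDoubleCovered_of_mem_lonelyEdges (e := s(v, r)) ?_
    rw [h.lonelyEdges_eq]
    exact Set.mem_insert _ _

end IsSeed

universe u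

lemma IsSeed.exists_ncard_cliqueSet_eq {V : Type u} [Fintype V] {G : SimpleGraph V} {v p q r : V}
    {F : Set (Sym2 V)} (h : IsSeed G v p q r F) (n : ℕ) :
    ∃ (W : Type u) (_ : Fintype W) (G' : SimpleGraph W) (v' p' q' r' : W) (F' : Set (Sym2 W)),
      IsSeed G' v' p' q' r' F' ∧ F'.ncard = F.ncard ∧
        (G'.cliqueSet 3).ncard = (G.cliqueSet 3).ncard + n := by
  induction n with
  | zero => exact ⟨V, _, G, v, p, q, r, F, h, rfl, rfl⟩
  | succ n ih =>
    obtain ⟨W, _, G', v', p', q', r', F', h', hF, hcard⟩ := ih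
    refine ⟨_, inferInstance, _, _, _, _, _, _, h'.truncateTwice, ?_, ?_⟩
    · rw [Set.ncard_image_of_injective _ (Sym2.map.injective Sum.inl_injective),
        Set.ncard_image_of_injective _ (Sym2.map.injective Sum.inl_injective), hF]
    · rw [h'.hasNeighbors.ncard_cliqueSet_truncateTwice h'.notMem_triangle, hcard, add_assoc]

lemma IsSeed.exists_inUWith {V : Type u} [Fintype V] {G : SimpleGraph V} {v p q r : V}
    {F : Set (Sym2 V)} (h : IsSeed G v p q r F) {k : ℕ} (hk : (G.cliqueSet 3).ncard ≤ k) :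
    ∃ (W : Type u) (_ : Fintype W) (_ : DecidableEq W) (G' : SimpleGraph W)
      (_ : DecidableRel G'.Adj), InUWith G' (F.ncard + 1) ∧ (G'.cliqueFinset 3).card = k := by
  classical
  obtain ⟨n, rfl⟩ := exists_add_of_le hk
  obtain ⟨W, _, G', v', p', q', r', F', h', hF, hcard⟩ := h.exists_ncard_cliqueSet_eq n
  refine ⟨W, inferInstance, inferInstance, G', inferInstance, hF ▸ h'.inUWith, ?_⟩
  rw [← hcard, ← SimpleGraph.coe_cliqueFinset, Set.ncard_coe_finset]

end Seeds

section Search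

variable {V : Type*} [DecidableEq V] {N : V → List V}

/-- Backtracking search for involutions: the fixed points of the partial pairing `f` are the
vertices that are still free, and each free vertex `v` of the list is paired with an element of
`N v`. -/
def completions (N : V → List V) : List V → (V → V) → List (V → V)
  | [], f => [f]
  | v :: vs, f =>
    if f v = v then
      (N v).flatMap fun w =>
        if f w = w then completions N vs (Function.update (Function.update f v w) w v) else []
    else completions N vs f

lemma mem_completions {g : V → V} (hg : Function.Involutive g) (hN : ∀ v, g v ∈ N v) {vs : List V}
    {f : V → V} (hfree : ∀ v, f v = g v ∨ f v = v ∧ f (g v) = g v) (hvs : ∀ v ∉ vs, f v = g v) :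
    g ∈ completions N vs f := by
  induction vs generalizing f with
  | nil => simp [completions, funext fun v => (hvs v List.not_mem_nil).symm]
  | cons v vs ih =>
    rw [completions]
    split_ifs with hv
    · refine List.mem_flatMap.2 ⟨g v, hN v, ?_⟩
      have hgg (u : V) : g (g u) = u := hg u
      have hgv : f (g v) = g v := by grind
      rw [if_pos hgv]
      apply ih <;> grind
    · apply ih hfree
      grind

/-- Depth-first search: adds to the list `C` of visited vertices those that are reached from the
stack, with `m` bounding the number of steps. -/
def depthFirstSearch (N : V → List V) : (m : ℕ) → (stack : List V) → (C : List V) → List V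
  | m + 1, v :: stack, C =>
    if v ∈ C then depthFirstSearch N m stack C
    else depthFirstSearch N m (N v ++ stack) (v :: C)
  | _, _, C => C

lemma forall_mem_depthFirstSearch {P : V → Prop} {S : Finset V}
    (hP : ∀ a ∉ S, P a → ∀ b ∈ N a, b ∉ S → P b) {m : ℕ} {stack C : List V} (hSC : ∀ b ∈ S, b ∈ C)
    (hstack : ∀ b ∈ stack, b ∉ S → P b) (hC : ∀ b ∈ C, b ∉ S → P b) :
    ∀ b ∈ depthFirstSearch N m stack C, b ∉ S → P b := by
  induction m generalizing stack C with
  | zero => simpa [depthFirstSearch] using hC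
  | succ m ih =>
    cases stack with
    | nil => simpa [depthFirstSearch] using hC
    | cons v stack =>
      rw [depthFirstSearch]
      split_ifs with hv
      · exact ih hSC (List.forall_mem_cons.1 hstack).2 hC
      · apply ih <;> grind

end Search

section Decision

variable {n : ℕ} {G : SimpleGraph (Fin n)} [DecidableRel G.Adj]

variable (G) in
/-- The neighbors of a vertex, in increasing order. -/
def neighborList (v : Fin n) : List (Fin n) :=
  (List.finRange n).filter fun w => G.Adj v w

lemma mem_neighborList {v w : Fin n} : w ∈ neighborList G v ↔ G.Adj v w := by
  simp [neighborList]

instance {S : Finset (Fin n)} {f : Fin n → Fin n} : Decidable (IsMating G S f) :=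
  decidable_of_iff ((∀ v, f (f v) = v) ∧ (∀ v ∈ S, f v = v) ∧ ∀ v ∉ S, G.Adj v (f v))
    ⟨fun ⟨hinv, hfix, hadj⟩ => ⟨hinv, hfix, hadj⟩, fun ⟨hinv, hfix, hadj⟩ => ⟨hinv, hfix, hadj⟩⟩

variable (G) in
/-- The perfect matchings of `G - S`, found by backtracking. -/
def matingsFinset (S : Finset (Fin n)) : Finset (Fin n → Fin n) :=
  (completions (fun v => if v ∈ S then [v] else neighborList G v)
    (List.finRange n) id).toFinset.filter (IsMating G S)

lemma mem_matingsFinset {S : Finset (Fin n)} {f : Fin n → Fin n} :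
    f ∈ matingsFinset G S ↔ IsMating G S f := by
  simp only [matingsFinset, Finset.mem_filter, List.mem_toFinset, and_iff_right_iff_imp]
  intro hf
  refine mem_completions hf.involutive (fun v => ?_) (fun v => by simp) (by simp)
  split_ifs with hv
  · simpa using hf.fixed v hv
  · exact mem_neighborList.2 (hf.adj v hv)

variable (G) in
/-- The set `matingsThrough G S e`, in a form that the kernel can evaluate. -/
def matingsThroughFinset (S : Finset (Fin n)) (e : Sym2 (Fin n)) : Finset (Fin n → Fin n) :=
  {f ∈ matingsFinset G S | ∃ a ∉ S, s(a, f a) = e}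

lemma coe_matingsThroughFinset {S : Finset (Fin n)} {e : Sym2 (Fin n)} :
    (matingsThroughFinset G S e : Set (Fin n → Fin n)) = matingsThrough G S e := by
  ext f
  simp [matingsThroughFinset, matingsThrough, mem_matingsFinset]

lemma exists_matingsThrough_eq_singleton_iff {e : Sym2 (Fin n)} :
    (∃ f, matingsThrough G ∅ e = {f}) ↔ (matingsThroughFinset G ∅ e).card = 1 := by
  simp only [← Finset.coe_empty, ← coe_matingsThroughFinset, Finset.card_eq_one,
    Finset.coe_eq_singleton]

lemma isDoubleCoveredOff_iff {E : Finset (Sym2 (Fin n))} :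
    IsDoubleCoveredOff G E ↔
      ∀ a b, G.Adj a b → s(a, b) ∉ E → 1 < (matingsThroughFinset G ∅ s(a, b)).card := by
  simp only [IsDoubleCoveredOff, Sym2.forall, SimpleGraph.mem_edgeSet, Finset.mem_coe,
    Finset.one_lt_card_iff_nontrivial, ← Finset.coe_empty, ← coe_matingsThroughFinset]

lemma isLonelyPattern_of_card {v p q r : Fin n} {F : Finset (Sym2 (Fin n))}
    (hasNeighbors : HasNeighbors G v p q r)
    (spoke : (matingsThroughFinset G ∅ s(v, r)).card = 1) (notMem : ∀ e ∈ F, v ∉ e)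
    (unique : ∀ e ∈ F, (matingsThroughFinset G ∅ e).card = 1 ∧
      {f ∈ matingsThroughFinset G ∅ e | f v ≠ q} = ∅)
    (tripod : (matingsFinset G {v, p, q, r}).Nonempty)
    (tripodThrough : ∀ e ∈ F, matingsThroughFinset G {v, p, q, r} e = ∅)
    (doubleCoveredOff : ∀ a b, G.Adj a b → s(a, b) ∉ insert s(v, r) F →
      1 < (matingsThroughFinset G ∅ s(a, b)).card) :
    IsLonelyPattern G v p q r F where
  hasNeighbors := hasNeighbors
  spoke := exists_matingsThrough_eq_singleton_iff.2 spoke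
  notMem := notMem
  unique e he := by
    obtain ⟨f, hf⟩ := exists_matingsThrough_eq_singleton_iff.2 (unique e he).1
    have hmem : f ∈ matingsThroughFinset G ∅ e := by
      simp [← Finset.mem_coe, coe_matingsThroughFinset, hf]
    exact ⟨f, hf, not_not.1 (Finset.filter_eq_empty_iff.1 (unique e he).2 hmem)⟩
  tripod := by
    obtain ⟨t, ht⟩ := tripod
    refine ⟨t, ?_⟩
    simpa [hasNeighbors.closedNeighborSet_eq] using mem_matingsFinset.1 ht
  tripodThrough e he := by
    rw [hasNeighbors.closedNeighborSet_eq]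
    simpa [coe_matingsThroughFinset] using Finset.coe_eq_empty.2 (tripodThrough e he)
  doubleCoveredOff := by
    simpa using isDoubleCoveredOff_iff.2 doubleCoveredOff

lemma isVertexConnected_of_depthFirstSearch {k : ℕ} (hk : k < n) (m : ℕ)
    (h : ∀ i < k, ∀ l ∈ (List.finRange n).sublistsLen i,
      ∃ a, ∀ b, b ∈ depthFirstSearch (neighborList G) m [a] l) :
    IsVertexConnected G k := by
  refine isVertexConnected_iff.2 ⟨by simpa using hk, fun S hS C hC => ?_⟩
  have hmem : ∀ b, b ∈ (List.finRange n).filter (· ∈ S) ↔ b ∈ S := by simp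
  have hlength : ((List.finRange n).filter (· ∈ S)).length = S.card := by
    rw [← List.toFinset_card_of_nodup ((List.nodup_finRange n).filter _), List.toFinset_filter]
    simp
  obtain ⟨c, hc⟩ := h _ hS _ (List.mem_sublistsLen.2 ⟨List.filter_sublist, hlength⟩)
  have hcC : ∀ b ∉ S, (c ∈ C ↔ b ∈ C) := fun b hb =>
    forall_mem_depthFirstSearch (P := fun b => c ∈ C ↔ b ∈ C)
      (fun a ha haC b hab hb => haC.trans (hC a ha b hb (mem_neighborList.1 hab)))
      (fun b hb => (hmem b).2 hb) (by simp) (fun b hb hbS => absurd ((hmem b).1 hb) hbS)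
      b (hc b) hb
  exact fun a ha b hb => (hcC a ha).symm.trans (hcC b hb)

end Decision

lemma cliqueSet_three_subset {V : Type*} [DecidableEq V] {G : SimpleGraph V} {T : Set (Finset V)}
    (h : ∀ a b c, G.Adj a b → G.Adj a c → G.Adj b c → {a, b, c} ∈ T) : G.cliqueSet 3 ⊆ T := by
  intro s hs
  obtain ⟨a, b, c, hab, hac, hbc, rfl⟩ := SimpleGraph.is3Clique_iff.1 hs
  exact h a b c hab hac hbc

/-- A graph found by computer search, with lonely edges `s(13, 0)` and `s(6, 11)` and with two
triangles; row `v` of the table lists the neighbours of `v`. -/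
def seedTwo : SimpleGraph (Fin 14) :=
  SimpleGraph.fromRel fun v w => w ∈ (![[12, 7, 13], [2, 8, 10], [1, 13, 5], [11, 4, 9], [9, 3, 6],
    [10, 12, 2], [4, 11, 7], [0, 8, 6], [9, 7, 1], [8, 4, 3], [5, 1, 12], [3, 6, 13], [0, 5, 10],
    [2, 0, 11]] v : List (Fin 14))

instance : DecidableRel seedTwo.Adj :=
  inferInstanceAs (DecidableRel (SimpleGraph.fromRel _).Adj)

lemma cliqueSet_seedTwo_subset : seedTwo.cliqueSet 3 ⊆ {{3, 4, 9}, {5, 10, 12}} :=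
  cliqueSet_three_subset (by decide +kernel)

lemma ncard_cliqueSet_seedTwo_le : (seedTwo.cliqueSet 3).ncard ≤ 2 :=
  (Set.ncard_le_ncard cliqueSet_seedTwo_subset).trans ((Set.ncard_insert_le _ _).trans (by simp))

lemma isLonelyPattern_seedTwo : IsLonelyPattern seedTwo 13 11 2 0 {s(6, 11)} := by
  rw [← Finset.coe_singleton]
  refine isLonelyPattern_of_card ⟨?_, ?_, ?_, ?_⟩ ?_ ?_ ?_ ?_ ?_ ?_ <;> decide +kernel

lemma isSeed_seedTwo : IsSeed seedTwo 13 11 2 0 {s(6, 11)} where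
  toIsLonelyPattern := isLonelyPattern_seedTwo
  cubic := isRegularOfDegree_three_iff.1 fun v => by revert v; decide +kernel
  isVertexConnected := isVertexConnected_of_depthFirstSearch (by simp) (3 * 14) (by decide +kernel)
  notMem_triangle s hs := by
    obtain rfl | rfl := cliqueSet_seedTwo_subset hs <;> decide

/-- A graph found by computer search, with lonely edge `s(5, 0)` and with two triangles; row `v` of
the table lists the neighbours of `v`. -/
def seedOne : SimpleGraph (Fin 16) :=
  SimpleGraph.fromRel fun v w => w ∈ (![[15, 11, 5], [5, 12, 10], [9, 6, 14], [10, 8, 4], [5, 7, 3],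
    [1, 4, 0], [9, 2, 13], [4, 8, 15], [15, 3, 7], [12, 6, 2], [3, 14, 1], [0, 13, 12], [9, 11, 1],
    [14, 11, 6], [10, 13, 2], [0, 8, 7]] v : List (Fin 16))

instance : DecidableRel seedOne.Adj :=
  inferInstanceAs (DecidableRel (SimpleGraph.fromRel _).Adj)

lemma cliqueSet_seedOne_subset : seedOne.cliqueSet 3 ⊆ {{2, 6, 9}, {7, 8, 15}} :=
  cliqueSet_three_subset (by decide +kernel)

lemma ncard_cliqueSet_seedOne_le : (seedOne.cliqueSet 3).ncard ≤ 2 :=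
  (Set.ncard_le_ncard cliqueSet_seedOne_subset).trans ((Set.ncard_insert_le _ _).trans (by simp))

lemma isLonelyPattern_seedOne : IsLonelyPattern seedOne 5 4 1 0 ∅ := by
  rw [← Finset.coe_empty]
  refine isLonelyPattern_of_card ⟨?_, ?_, ?_, ?_⟩ ?_ ?_ ?_ ?_ ?_ ?_ <;> decide +kernel

lemma isSeed_seedOne : IsSeed seedOne 5 4 1 0 ∅ where
  toIsLonelyPattern := isLonelyPattern_seedOne
  cubic := isRegularOfDegree_three_iff.1 fun v => by revert v; decide +kernel
  isVertexConnected := isVertexConnected_of_depthFirstSearch (by simp) (3 * 16) (by decide +kernel)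
  notMem_triangle s hs := by
    obtain rfl | rfl := cliqueSet_seedOne_subset hs <;> decide

end LonelyEdges

theorem mainTheorem6 (k : ℕ) (hk : 2 ≤ k) :
    (∃ (V : Type) (_ : Fintype V) (_ : DecidableEq V) (G : SimpleGraph V)
        (_ : DecidableRel G.Adj),
      LonelyEdges.InUWith G 2 ∧ (G.cliqueFinset 3).card = k) ∧
    (∃ (V : Type) (_ : Fintype V) (_ : DecidableEq V) (G : SimpleGraph V)
        (_ : DecidableRel G.Adj),
      LonelyEdges.InUWith G 1 ∧ (G.cliqueFinset 3).card = k) := by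
  have htwo := LonelyEdges.isSeed_seedTwo.exists_inUWith
    (LonelyEdges.ncard_cliqueSet_seedTwo_le.trans hk)
  have hone := LonelyEdges.isSeed_seedOne.exists_inUWith
    (LonelyEdges.ncard_cliqueSet_seedOne_le.trans hk)
  rw [Set.ncard_singleton] at htwo
  rw [Set.ncard_empty] at hone
  exact ⟨htwo, hone⟩
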